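/- Let $d \ge 2$ and let $g$ be the Coulomb kernel on $\mathbf{R}^d$ with $-\Delta g = \delta_0$, that is $g(x) = -\frac{1}{2\pi}\log|x|$ if $d=2$ and $g(x) = \frac{1}{(d-2)|S^{d-1}|}\,|x|^{2-d}$ if $d \ge 3$. Let $V \in C^2(\mathbf{R}^d)$ with $V \ge 0$. Put $U = V$ if $d \ge 3$ and $U(x) = V(x) - \log|x|$ if $d = 2$, and assume that $U(x) \to \infty$ as $|x| \to \infty$. Let $(\beta_N)$ be a sequence of real numbers such that $N\beta_N \to \infty$, and assume that there is a compact set $K_0 \subset \mathbf{R}^d$ such that for every $c > 0$ $$ \lim_{N \to \infty} N^{\frac1d} \int_{\mathbf{R}^d \setminus K_0} \exp\left(-c N \beta_N U(x)\right) dx = 0 . $$ For all large $N$ let $\mu_{\beta_N}$ be the thermal equilibrium measure, that is, the minimizer over all probability measures $\mu$ on $\mathbf{R}^d$ of $$ \frac12 \iint g(x-y)\, d\mu(x)\, d\mu(y) + \int V \, d\mu + \frac{1}{N\beta_N} \int \mu \log \mu \, dx , $$ where $\mu$ also denotes the density, and the value is $+\infty$ if $\mu$ has no density or if one of the three terms is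 not a (finite) absolutely convergent integral. For a finite signed measure $s$ on $\mathbf{R}^d$ let $$ \|s\|_{BL} = \sup_{f \in W^{1,\infty}(\mathbf{R}^d)} \frac{\int f \, ds}{\|f\|_{W^{1,\infty}}}, \qquad \|f\|_{W^{1,\infty}} = \max\{\|f\|_{L^\infty}, \|\nabla f\|_{L^\infty}\}, $$ where $\nabla f$ is the weak gradient, $f$ is represented by its continuous representative, and $f \neq 0$. Let $\epsilon > 0$ and let $(\nu_N)$ be a sequence of probability measures on $\mathbf{R}^d$ such that, for all large $N$, $$ \|\nu_N - \mu_{\beta_N}\|_{BL} \ge \frac{\epsilon}{N^{1/d}} . $$ Then there are a compact set $K^* \subset \mathbf{R}^d$ and an $N_0$ such that for all $N \ge N_0$ and every compact set $K \supseteq K^*$ (in particular for $K = K^*$) $$ \|(\nu_N - \mu_{\beta_N}) \mathbf{1}_{K}\|_{BL} \ge \frac{\epsilon}{4 N^{1/d}} . $$ -/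

import Mathlib

open MeasureTheory Filter Topology
open scoped ENNReal ContDiff

noncomputable section

/-- `G` is the weak (distributional) gradient of `f` on `ℝ^d`:
`∫ f ∂_v φ = - ∫ ⟨G, v⟩ φ` for all test functions `φ` and all directions `v`. -/
def IsWeakGradient {d : ℕ} (f : EuclideanSpace ℝ (Fin d) → ℝ)
    (G : EuclideanSpace ℝ (Fin d) → EuclideanSpace ℝ (Fin d)) : Prop :=
  LocallyIntegrable f volume ∧ LocallyIntegrable G volume ∧
    ∀ φ : EuclideanSpace ℝ (Fin d) → ℝ, ContDiff ℝ ∞ φ → HasCompactSupport φ →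
      ∀ v : EuclideanSpace ℝ (Fin d),
        ∫ x, f x * fderiv ℝ φ x v = - ∫ x, inner ℝ (G x) v * φ x

/-- The `W^{1,∞}` norm `max (‖f‖_{L^∞}, ‖∇f‖_{L^∞})`, equal to `∞` when `f` is not weakly
differentiable. The weak gradient is unique almost everywhere, so that the infimum
over `G` has at most one value to choose from. -/
def w1infNorm {d : ℕ} (f : EuclideanSpace ℝ (Fin d) → ℝ) : ℝ≥0∞ :=
  ⨅ (G : EuclideanSpace ℝ (Fin d) → EuclideanSpace ℝ (Fin d)) (_ : IsWeakGradient f G),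
    max (eLpNorm f ⊤ volume) (eLpNorm G ⊤ volume)

/-- The bounded Lipschitz norm of a finite signed measure, `sup_f ∫ f ds / ‖f‖_{W^{1,∞}}` over
`f ∈ W^{1,∞}(ℝ^d)`. Since `s` may charge Lebesgue-null sets, each class in `W^{1,∞}` is
represented by its continuous representative. The quotient is `0` for `f = 0`. The supremum is
nonnegative as `f` may be replaced by `-f`, so cutting negative values off at `0` is harmless. -/
def blNorm {d : ℕ} (s : SignedMeasure (EuclideanSpace ℝ (Fin d))) : ℝ≥0∞ :=
  ⨆ f : {f : EuclideanSpace ℝ (Fin d) → ℝ // Continuous f ∧ w1infNorm f < ⊤},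
    ENNReal.ofReal (s.integral f.1 (ContinuousLinearMap.lsmul ℝ ℝ)) / w1infNorm f.1

/-- The difference `ν - μ` of two probability measures, as a signed measure. -/
def probDiff {d : ℕ} (ν μ : ProbabilityMeasure (EuclideanSpace ℝ (Fin d))) :
    SignedMeasure (EuclideanSpace ℝ (Fin d)) :=
  (ν : Measure (EuclideanSpace ℝ (Fin d))).toSignedMeasure -
    (μ : Measure (EuclideanSpace ℝ (Fin d))).toSignedMeasure

/-- The Coulomb kernel on `ℝ^d`, `d ≥ 2`, normalized by `-Δ g = δ₀`: it is `-log |x| / (2π)` for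
`d = 2`, and `|x|^{2-d} / ((d - 2) |S^{d-1}|)` for `d ≥ 3`, where `|S^{d-1}| = d |B_1|`. -/
def coulombKernel {d : ℕ} (x : EuclideanSpace ℝ (Fin d)) : ℝ :=
  if d = 2 then -(1 / (2 * Real.pi)) * Real.log ‖x‖
  else 1 / (((d : ℝ) - 2) *
      (d * (volume : Measure (EuclideanSpace ℝ (Fin d))).real (Metric.ball 0 1))) /
    ‖x‖ ^ (d - 2)

/-- Each term of the free energy of `μ` is finite; in particular `μ` has a density. -/
def HasFiniteFreeEnergy {d : ℕ} (V : EuclideanSpace ℝ (Fin d) → ℝ)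
    (μ : ProbabilityMeasure (EuclideanSpace ℝ (Fin d))) : Prop :=
  (μ : Measure (EuclideanSpace ℝ (Fin d))) ≪ volume ∧
  Integrable (fun p : EuclideanSpace ℝ (Fin d) × EuclideanSpace ℝ (Fin d) =>
      coulombKernel (p.1 - p.2))
    ((μ : Measure (EuclideanSpace ℝ (Fin d))).prod (μ : Measure (EuclideanSpace ℝ (Fin d)))) ∧
  Integrable V (μ : Measure (EuclideanSpace ℝ (Fin d))) ∧
  Integrable (fun x => ((μ : Measure (EuclideanSpace ℝ (Fin d))).rnDeriv volume x).toReal *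
    Real.log ((μ : Measure (EuclideanSpace ℝ (Fin d))).rnDeriv volume x).toReal) volume

open Classical in
/-- The free energy
`½ ∬ g(x - y) dμ(x) dμ(y) + ∫ V dμ + (1/θ) ∫ μ log μ`, with value `+∞` unless every term is
finite. -/
def freeEnergy {d : ℕ} (V : EuclideanSpace ℝ (Fin d) → ℝ) (θ : ℝ)
    (μ : ProbabilityMeasure (EuclideanSpace ℝ (Fin d))) : EReal :=
  if HasFiniteFreeEnergy V μ then
    ((1 / 2 * (∫ p : EuclideanSpace ℝ (Fin d) × EuclideanSpace ℝ (Fin d),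
            coulombKernel (p.1 - p.2)
          ∂((μ : Measure (EuclideanSpace ℝ (Fin d))).prod
            (μ : Measure (EuclideanSpace ℝ (Fin d)))))
        + (∫ x, V x ∂(μ : Measure (EuclideanSpace ℝ (Fin d))))
        + 1 / θ * (∫ x, ((μ : Measure (EuclideanSpace ℝ (Fin d))).rnDeriv volume x).toReal *
            Real.log ((μ : Measure (EuclideanSpace ℝ (Fin d))).rnDeriv volume x).toReal) : ℝ) :
      EReal)
  else ⊤

/-- `μ` is the thermal equilibrium measure at `θ = Nβ`: it minimizes the free energy among all
probability measures on `ℝ^d`. -/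
def IsThermalEquilibrium {d : ℕ} (V : EuclideanSpace ℝ (Fin d) → ℝ) (θ : ℝ)
    (μ : ProbabilityMeasure (EuclideanSpace ℝ (Fin d))) : Prop :=
  ∀ σ : ProbabilityMeasure (EuclideanSpace ℝ (Fin d)), freeEnergy V θ μ ≤ freeEnergy V θ σ

/-- The function that measures the confinement by `V`: it is `V` for `d ≥ 3` and
`V - log |x|` for `d = 2`. -/
def confinement {d : ℕ} (V : EuclideanSpace ℝ (Fin d) → ℝ) (x : EuclideanSpace ℝ (Fin d)) : ℝ :=
  if d = 2 then V x - Real.log ‖x‖ else V x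

end

/-! ### The bounded Lipschitz norm -/

section BoundedLipschitz

variable {d : ℕ}

/-! Restricting `ν - μ` to `K` loses only what lies outside `K`, and testing with a constant shows
that `ν` cannot have much more mass there than `μ` without the restricted norm noticing. This gives
`‖ν - μ‖ ≤ 2 ‖(ν - μ) 1_K‖ + 2 μ(Kᶜ)` (`blNorm_probDiff_le`), so it suffices to find a fixed compact
set outside which `μ_{β_N}` has mass at most `ε / (4 N^{1/d})`.

That tail bound uses only minimality. Let `θ = Nβ_N` and compare `μ` with its conditioning on a
large ball `K`. With `m = μ(Kᶜ)`, renormalizing costs `O(m)`, while discarding the exterior saves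
its potential energy and entropy. The negative part of `g` (present for `d = 2`) is absorbed into
the potential, leaving `W ≥ 0`. If `W` is large off `K`, half of it pays for the `O(m)` error, and
`½ ∫_{Kᶜ} W dμ + (1/θ) ∫_{Kᶜ} μ log μ ≤ 0` remains (`half_add_nonpos_of_conditioning`). The Gibbs
inequality `sub_exp_neg_le_mul_log_add` turns this into `m ≤ ∫_{Kᶜ} exp(-θW/2)`, which the tail
hypothesis with `c = 1/2` makes `o(N^{-1/d})`. The ball is independent of `θ ≥ 1` because the energy
bounds are (`exists_freeEnergy_le`). -/

lemma eLpNorm_top_le_w1infNorm (f : EuclideanSpace ℝ (Fin d) → ℝ) :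
    eLpNorm f ⊤ volume ≤ w1infNorm f :=
  le_iInf₂ fun _ _ => le_max_left _ _

/-- A set of full Lebesgue measure is dense, so continuity upgrades the essential bound to every
point. This is needed because `ν` may charge Lebesgue-null sets. -/
lemma abs_le_w1infNorm {f : EuclideanSpace ℝ (Fin d) → ℝ} (hf : Continuous f)
    (hw : w1infNorm f < ⊤) (x : EuclideanSpace ℝ (Fin d)) : |f x| ≤ (w1infNorm f).toReal := by
  have hae : ∀ᵐ y ∂(volume : Measure (EuclideanSpace ℝ (Fin d))),
      |f y| ≤ (w1infNorm f).toReal := by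
    filter_upwards [enorm_ae_le_eLpNormEssSup f volume] with y hy
    have h := hy.trans (eLpNorm_exponent_top (f := f) ▸ eLpNorm_top_le_w1infNorm f)
    simpa using ENNReal.toReal_mono hw.ne h
  have hdense : Dense {y | |f y| ≤ (w1infNorm f).toReal} := Measure.dense_of_ae hae
  have hclosed : IsClosed {y | |f y| ≤ (w1infNorm f).toReal} :=
    isClosed_le hf.abs continuous_const
  exact (hclosed.closure_eq ▸ hdense.closure_eq ▸ Set.mem_univ x : _)

lemma w1infNorm_eq_zero {f : EuclideanSpace ℝ (Fin d) → ℝ} (hf : Continuous f)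
    (hw : w1infNorm f = 0) : f = 0 := by
  ext x
  have := abs_le_w1infNorm hf (by simp [hw]) x
  simpa [hw] using this

lemma isWeakGradient_const (c : ℝ) :
    IsWeakGradient (fun _ : EuclideanSpace ℝ (Fin d) => c) 0 := by
  refine ⟨locallyIntegrable_const c, locallyIntegrable_zero, fun φ hφ hc v => ?_⟩
  have h : ∫ x, fderiv ℝ φ x v = 0 := by
    have hi : Integrable (fun x => fderiv ℝ φ x v) :=
      ((hφ.continuous_fderiv (by simp)).clm_apply continuous_const).integrable_of_hasCompactSupport
        (hc.fderiv_apply ℝ v)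
    simpa using integral_mul_fderiv_eq_neg_fderiv_mul_of_integrable
      (f := fun _ => (1 : ℝ)) (g := φ) (v := v) (μ := volume) (by simp) (by simpa using hi)
      (by simpa using hφ.continuous.integrable_of_hasCompactSupport hc)
      (fun x _ => differentiableAt_const _) (fun x _ => (hφ.differentiable (by simp)) x)
  simp [integral_const_mul, h]

lemma w1infNorm_const_le (c : ℝ) :
    w1infNorm (fun _ : EuclideanSpace ℝ (Fin d) => c) ≤ ENNReal.ofReal |c| := by
  refine (iInf₂_le 0 (isWeakGradient_const c)).trans (max_le ?_ (by simp))
  rw [eLpNorm_exponent_top]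
  refine essSup_le_of_ae_le _ (Eventually.of_forall fun x => ?_)
  simp [Real.enorm_eq_ofReal_abs]

lemma integral_le_blNorm_mul {s : SignedMeasure (EuclideanSpace ℝ (Fin d))} (hs : blNorm s ≠ ⊤)
    {f : EuclideanSpace ℝ (Fin d) → ℝ} (hf : Continuous f) (hw : w1infNorm f < ⊤) :
    s.integral f (ContinuousLinearMap.lsmul ℝ ℝ) ≤ (blNorm s).toReal * (w1infNorm f).toReal := by
  rcases eq_or_ne (w1infNorm f) 0 with h0 | h0
  · rw [w1infNorm_eq_zero hf h0]
    exact VectorMeasure.integral_zero.trans_le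
      (mul_nonneg ENNReal.toReal_nonneg ENNReal.toReal_nonneg)
  have h := le_iSup (fun f : {f : EuclideanSpace ℝ (Fin d) → ℝ //
    Continuous f ∧ w1infNorm f < ⊤} =>
    ENNReal.ofReal (s.integral f.1 (ContinuousLinearMap.lsmul ℝ ℝ)) / w1infNorm f.1) ⟨f, hf, hw⟩
  have h' := (ENNReal.div_le_iff h0 hw.ne).1 h
  rw [← ENNReal.toReal_mul]
  exact (ENNReal.ofReal_le_iff_le_toReal (ENNReal.mul_ne_top hs hw.ne)).1 h'

lemma integrable_of_w1infNorm_lt_top {f : EuclideanSpace ℝ (Fin d) → ℝ} (hf : Continuous f)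
    (hw : w1infNorm f < ⊤) (μ : Measure (EuclideanSpace ℝ (Fin d))) [IsFiniteMeasure μ] :
    Integrable f μ :=
  Integrable.of_bound hf.aestronglyMeasurable _
    (Eventually.of_forall fun x => abs_le_w1infNorm hf hw x)

lemma integral_toSignedMeasure_sub {f : EuclideanSpace ℝ (Fin d) → ℝ}
    (μ ν : Measure (EuclideanSpace ℝ (Fin d))) [IsFiniteMeasure μ] [IsFiniteMeasure ν]
    (hμ : Integrable f μ) (hν : Integrable f ν) :
    (μ.toSignedMeasure - ν.toSignedMeasure).integral f (ContinuousLinearMap.lsmul ℝ ℝ) =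
      ∫ x, f x ∂μ - ∫ x, f x ∂ν := by
  have key : ∀ κ : Measure (EuclideanSpace ℝ (Fin d)), ∀ _ : IsFiniteMeasure κ,
      κ.toSignedMeasure.integral f (ContinuousLinearMap.lsmul ℝ ℝ) = ∫ x, f x ∂κ := by
    intro κ _
    rw [← VectorMeasure.integral_toSignedMeasure]
    congr 1
    ext
    simp
  rw [VectorMeasure.integral_sub_vectorMeasure, key, key]
  · simpa [VectorMeasure.Integrable] using hμ
  · simpa [VectorMeasure.Integrable] using hν

lemma blNorm_probDiff_le (ν μ : ProbabilityMeasure (EuclideanSpace ℝ (Fin d)))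
    {K : Set (EuclideanSpace ℝ (Fin d))} (hK : MeasurableSet K) :
    blNorm (probDiff ν μ) ≤ 2 * blNorm ((probDiff ν μ).restrict K) +
      2 * (μ : Measure (EuclideanSpace ℝ (Fin d))) Kᶜ := by
  rcases eq_or_ne (blNorm ((probDiff ν μ).restrict K)) ⊤ with htop | htop
  · simp [htop]
  set B := (blNorm ((probDiff ν μ).restrict K)).toReal with hB
  set μ' : Measure (EuclideanSpace ℝ (Fin d)) := ↑μ
  set ν' : Measure (EuclideanSpace ℝ (Fin d)) := ↑ν
  have hres : (probDiff ν μ).restrict K =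
      (ν'.restrict K).toSignedMeasure - (μ'.restrict K).toSignedMeasure := by
    rw [probDiff, VectorMeasure.restrict_sub, VectorMeasure.restrict_toSignedMeasure hK,
      VectorMeasure.restrict_toSignedMeasure hK]
  have htest : ∀ f : EuclideanSpace ℝ (Fin d) → ℝ, Continuous f → w1infNorm f < ⊤ →
      ∫ x in K, f x ∂ν' - ∫ x in K, f x ∂μ' ≤ B * (w1infNorm f).toReal := by
    intro f hf hw
    rw [← integral_toSignedMeasure_sub _ _ (integrable_of_w1infNorm_lt_top hf hw _)
      (integrable_of_w1infNorm_lt_top hf hw _), ← hres]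
    exact integral_le_blNorm_mul htop hf hw
  have hB0 : 0 ≤ B := ENNReal.toReal_nonneg
  -- Testing with `-1` bounds `μ(K) - ν(K)`, which equals `ν(Kᶜ) - μ(Kᶜ)` since both total masses
  -- are one.
  have hcompl : ν'.real Kᶜ ≤ μ'.real Kᶜ + B := by
    have hc := w1infNorm_const_le (d := d) (-1)
    have h := htest (fun _ => -1) continuous_const (hc.trans_lt ENNReal.ofReal_lt_top)
    have h1 : (w1infNorm fun _ : EuclideanSpace ℝ (Fin d) => (-1 : ℝ)).toReal ≤ 1 := by
      simpa using ENNReal.toReal_mono ENNReal.ofReal_ne_top hc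
    have h2 := h.trans (mul_le_of_le_one_right hB0 h1)
    simp only [integral_const, measureReal_restrict_apply_univ, smul_eq_mul] at h2
    have := probReal_compl_eq_one_sub (μ := μ') hK
    have := probReal_compl_eq_one_sub (μ := ν') hK
    linarith
  refine iSup_le fun ⟨f, hf, hw⟩ => ?_
  rcases eq_or_ne (w1infNorm f) 0 with h0 | h0
  · obtain rfl := w1infNorm_eq_zero hf h0
    have h := VectorMeasure.integral_zero (μ := probDiff ν μ)
      (B := ContinuousLinearMap.lsmul ℝ ℝ (E := ℝ))
    change ENNReal.ofReal ((probDiff ν μ).integral 0 _) / _ ≤ _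
    simp [show (probDiff ν μ).integral 0 (ContinuousLinearMap.lsmul ℝ ℝ (E := ℝ)) = 0 from h]
  rw [ENNReal.div_le_iff h0 hw.ne]
  have hμ0 : μ' Kᶜ ≠ ⊤ := measure_ne_top _ _
  apply ENNReal.ofReal_le_of_le_toReal
  rw [ENNReal.toReal_mul, ENNReal.toReal_add (by finiteness) (by finiteness), ENNReal.toReal_mul,
    ENNReal.toReal_mul, ← hB, ← Measure.real]
  have hfi := fun κ : Measure (EuclideanSpace ℝ (Fin d)) => fun _ : IsFiniteMeasure κ =>
    integrable_of_w1infNorm_lt_top hf hw κ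
  have hbd : ∀ κ : Measure (EuclideanSpace ℝ (Fin d)), ∀ _ : IsFiniteMeasure κ,
      |∫ x in Kᶜ, f x ∂κ| ≤ (w1infNorm f).toReal * κ.real Kᶜ := by
    intro κ _
    rw [← Real.norm_eq_abs]
    exact norm_setIntegral_le_of_norm_le_const (measure_lt_top _ _)
      fun x _ => abs_le_w1infNorm hf hw x
  have e1 := abs_le.1 (hbd ν' inferInstance)
  have e2 := abs_le.1 (hbd μ' inferInstance)
  have e3 := htest f hf hw
  change (probDiff ν μ).integral f _ ≤ _
  rw [probDiff, integral_toSignedMeasure_sub _ _ (hfi _ inferInstance) (hfi _ inferInstance),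
    ← integral_add_compl hK (hfi ν' inferInstance), ← integral_add_compl hK (hfi μ' inferInstance)]
  have e4 := mul_le_mul_of_nonneg_left hcompl (ENNReal.toReal_nonneg (a := w1infNorm f))
  norm_num
  nlinarith [e1.2, e2.1]

end BoundedLipschitz

/-! ### Tail bounds for minimizers of a free energy -/

section FreeEnergyTail

/-- Pointwise Gibbs inequality: `log t ≥ 1 - 1/t` at `t = x e^a`, multiplied by `x`. -/
lemma sub_exp_neg_le_mul_log_add {x : ℝ} (hx : 0 ≤ x) (a : ℝ) :
    x - Real.exp (-a) ≤ x * Real.log x + a * x := by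
  rcases hx.eq_or_lt with rfl | hx
  · simp [Real.exp_nonneg]
  have h := Real.one_sub_inv_le_log_of_pos (mul_pos hx (Real.exp_pos a))
  rw [Real.log_mul hx.ne' (Real.exp_ne_zero a), Real.log_exp, mul_inv, ← Real.exp_neg] at h
  have := mul_le_mul_of_nonneg_left h hx.le
  have e : x * (1 - x⁻¹ * Real.exp (-a)) = x - Real.exp (-a) := by field_simp
  linarith

/-- The arithmetic of the comparison. The suffixes `K` and `c` mark integrals over `K` and `Kᶜ` of
`ℓ` (`L`), `V`, `W` and the entropy (`S`); `I`, `IK` are the interactions, `m` is the mass off `K`,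
and `c = 1/(1-m)`. The errors are `6Cm` from rescaling the interaction, `8Cm` from rescaling
potential plus entropy, `Cm` from the `ℓ`-shift on `K × K`, `2m` from `log c`, and `C₁m` from the
shift of `W`. Their sum is at most `Wc / 2`. -/
lemma half_add_nonpos_of_conditioning
    {m c τ C C₁ I IK LK Lc VK Vc Wc SK Sc : ℝ} (hc : c * (1 - m) = 1) (hm0 : 0 ≤ m)
    (hm : m ≤ 1 / 2) (hLK : 0 ≤ LK) (hLc : 0 ≤ Lc) (hτ1 : τ ≤ 1)
    (hI : IK + 2 * ((1 - m) * LK) ≤ I + 2 * (LK + Lc)) (hIC : I + 2 * (LK + Lc) ≤ 2 * C)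
    (hL : LK + Lc ≤ C) (hVS : VK + τ * SK ≤ 4 * C) (hVc : Vc = Wc + 2 * Lc - C₁ * m)
    (hcond : 1 / 2 * I + (VK + Vc) + τ * (SK + Sc) ≤
      1 / 2 * (c ^ 2 * IK) + c * VK + τ * (c * SK + Real.log c))
    (hW : m * (2 * (C₁ + 15 * C + 2)) ≤ Wc) : Wc / 2 + τ * Sc ≤ 0 := by
  have hc0 : 0 < c := by
    by_contra! hneg
    have : c * (1 - m) ≤ 0 := mul_nonpos_of_nonpos_of_nonneg hneg (by linarith)
    linarith
  have hcm : c - 1 = c * m := by linarith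
  have hc2 : c ≤ 2 := by
    have := mul_le_mul_of_nonneg_left hm hc0.le
    linarith
  have hc1 : c - 1 ≤ 2 * m := hcm ▸ mul_le_mul_of_nonneg_right hc2 hm0
  have hc1' : 0 ≤ c - 1 := hcm ▸ mul_nonneg hc0.le hm0
  have hC : 0 ≤ C := by linarith
  have hlog : τ * Real.log c ≤ 2 * m :=
    (mul_le_of_le_one_left (Real.log_nonneg (by linarith)) hτ1).trans
      ((Real.log_le_sub_one_of_pos hc0).trans hc1)
  have hIK : IK ≤ 2 * C := by
    have : 0 ≤ (1 - m) * LK := mul_nonneg (by linarith) hLK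
    linarith
  have hsq : (c ^ 2 - 1) * IK ≤ 12 * C * m := by
    have e : c ^ 2 - 1 = (c - 1) * (c + 1) := by ring
    have h1 : c ^ 2 - 1 ≤ 2 * m * 3 := by
      rw [e]
      gcongr
      linarith
    have h0 : 0 ≤ c ^ 2 - 1 := by
      rw [e]
      positivity
    calc (c ^ 2 - 1) * IK ≤ (c ^ 2 - 1) * (2 * C) := by gcongr
      _ ≤ 2 * m * 3 * (2 * C) := by gcongr
      _ = 12 * C * m := by ring
  have hVS' : (c - 1) * (VK + τ * SK) ≤ 2 * m * (4 * C) := by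
    calc (c - 1) * (VK + τ * SK) ≤ (c - 1) * (4 * C) := by gcongr
      _ ≤ 2 * m * (4 * C) := by gcongr
  have hLm : m * LK ≤ m * C := by
    gcongr
    linarith
  have key : Wc + τ * Sc ≤ m * (C₁ + 15 * C + 2) := by linarith
  linarith

variable {α : Type*} [MeasurableSpace α]

/-- The hypotheses on a probability measure `μ` with bounded free energy with respect to an
interaction `g` and a potential `V`, where `ℓ` bounds the negative part of `g` and `W` is the
part of `V` that is left after compensating `g` by `ℓ`. -/
structure FreeEnergyBound (vol μ : Measure α) (g : α × α → ℝ) (V ℓ W : α → ℝ)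
    (θ C₀ C₁ M : ℝ) : Prop where
  ac : μ ≪ vol
  integrable_g : Integrable g (μ.prod μ)
  integrable_V : Integrable V μ
  integrable_ent : Integrable
    (fun x => (μ.rnDeriv vol x).toReal * Real.log (μ.rnDeriv vol x).toReal) vol
  measurable_ℓ : Measurable ℓ
  ℓ_nonneg : ∀ x, 0 ≤ ℓ x
  W_nonneg : ∀ x, 0 ≤ W x
  W_eq : ∀ x, W x = V x - 2 * ℓ x + C₁
  le_g : ∀ q : α × α, -ℓ q.1 - ℓ q.2 ≤ g q
  one_le_θ : 1 ≤ θ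
  C₁_nonneg : 0 ≤ C₁
  integrable_exp : Integrable (fun x => Real.exp (-(θ * (W x / 2)))) vol
  integral_exp_le : ∫ x, Real.exp (-(θ * (W x / 2))) ∂vol ≤ M
  energy_le : 1 / 2 * (∫ q, g q ∂μ.prod μ) + ∫ x, V x ∂μ +
    1 / θ * (∫ x, (μ.rnDeriv vol x).toReal * Real.log (μ.rnDeriv vol x).toReal ∂vol) ≤ C₀

namespace FreeEnergyBound

variable {vol μ : Measure α} {g : α × α → ℝ}
  {V ℓ W : α → ℝ} {θ C₀ C₁ M : ℝ}

/-- The density of potential energy and entropy, made nonnegative. -/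
noncomputable def localEnergy (vol μ : Measure α) (W : α → ℝ) (θ : ℝ) (x : α) : ℝ :=
  (μ.rnDeriv vol x).toReal * (W x / 2) +
    1 / θ * ((μ.rnDeriv vol x).toReal * Real.log (μ.rnDeriv vol x).toReal) +
    1 / θ * Real.exp (-(θ * (W x / 2)))

/-- The Gibbs inequality with `a = θW/2`, divided by `θ`. -/
lemma density_le_localEnergy (h : FreeEnergyBound vol μ g V ℓ W θ C₀ C₁ M) (x : α) :
    1 / θ * (μ.rnDeriv vol x).toReal ≤ localEnergy vol μ W θ x := by
  have hθ : 0 < θ := by linarith [h.one_le_θ]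
  have h1 := sub_exp_neg_le_mul_log_add (ENNReal.toReal_nonneg (a := μ.rnDeriv vol x))
    (θ * (W x / 2))
  have h2 := mul_le_mul_of_nonneg_left h1 (one_div_pos.2 hθ).le
  have e : (μ.rnDeriv vol x).toReal * (W x / 2) =
    1 / θ * (θ * (W x / 2) * (μ.rnDeriv vol x).toReal) := by field_simp
  rw [localEnergy, e]
  linarith

lemma localEnergy_nonneg (h : FreeEnergyBound vol μ g V ℓ W θ C₀ C₁ M) (x : α) :
    0 ≤ localEnergy vol μ W θ x := by
  have hθ : 0 < θ := by linarith [h.one_le_θ]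
  exact le_trans (by positivity) (h.density_le_localEnergy x)

variable [IsProbabilityMeasure μ]

lemma integrable_ℓ (h : FreeEnergyBound vol μ g V ℓ W θ C₀ C₁ M) : Integrable ℓ μ := by
  refine Integrable.mono' (h.integrable_V.add (integrable_const C₁))
    h.measurable_ℓ.aestronglyMeasurable (Eventually.of_forall fun x => ?_)
  have h1 := h.W_nonneg x
  have h2 := h.ℓ_nonneg x
  have h3 := h.W_eq x
  rw [Real.norm_of_nonneg h2]
  simp only [Pi.add_apply]
  linarith

lemma integrable_W (h : FreeEnergyBound vol μ g V ℓ W θ C₀ C₁ M) : Integrable W μ := by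
  have : W = fun x => V x - 2 * ℓ x + C₁ := funext h.W_eq
  rw [this]
  exact (h.integrable_V.sub (h.integrable_ℓ.const_mul 2)).add (integrable_const _)

lemma integrable_g_add (h : FreeEnergyBound vol μ g V ℓ W θ C₀ C₁ M) :
    Integrable (fun q : α × α => g q + (ℓ q.1 + ℓ q.2)) (μ.prod μ) :=
  h.integrable_g.add ((h.integrable_ℓ.comp_fst μ).add (h.integrable_ℓ.comp_snd μ))

lemma integral_g_add (h : FreeEnergyBound vol μ g V ℓ W θ C₀ C₁ M) :
    ∫ q : α × α, g q + (ℓ q.1 + ℓ q.2) ∂μ.prod μ = ∫ q, g q ∂μ.prod μ + 2 * ∫ x, ℓ x ∂μ := by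
  have h1 := h.integrable_ℓ.comp_fst μ
  have h2 := h.integrable_ℓ.comp_snd μ
  rw [integral_add h.integrable_g (h1.fun_add h2), integral_add h1 h2, integral_fun_fst,
    integral_fun_snd]
  simp
  ring

lemma setIntegral_g_add (h : FreeEnergyBound vol μ g V ℓ W θ C₀ C₁ M) {K : Set α} :
    ∫ q in K ×ˢ K, g q + (ℓ q.1 + ℓ q.2) ∂μ.prod μ =
      ∫ q in K ×ˢ K, g q ∂μ.prod μ + 2 * (μ.real K * ∫ x in K, ℓ x ∂μ) := by
  have h1 := (h.integrable_ℓ.integrableOn (s := K)).comp_fst (μ.restrict K)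
  have h2 := (h.integrable_ℓ.integrableOn (s := K)).comp_snd (μ.restrict K)
  have h3 := h.integrable_g.integrableOn (s := K ×ˢ K)
  rw [IntegrableOn, ← Measure.prod_restrict] at h3
  rw [← Measure.prod_restrict, integral_add h3 (h1.fun_add h2), integral_add h1 h2, integral_fun_fst,
    integral_fun_snd]
  simp
  ring

lemma setIntegral_V (h : FreeEnergyBound vol μ g V ℓ W θ C₀ C₁ M) (K : Set α) :
    ∫ x in K, V x ∂μ = ∫ x in K, W x ∂μ + 2 * ∫ x in K, ℓ x ∂μ - C₁ * μ.real K := by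
  have e : V = fun x => W x + 2 * ℓ x - C₁ := funext fun x => by rw [h.W_eq]; ring
  have i1 := h.integrable_W.integrableOn (s := K)
  have i2 := (h.integrable_ℓ.const_mul 2).integrableOn (s := K)
  rw [e, integral_sub (i1.fun_add i2) (integrable_const _), integral_add i1 i2, integral_const_mul]
  simp [mul_comm]

lemma measureReal_compl_mul_le (h : FreeEnergyBound vol μ g V ℓ W θ C₀ C₁ M) {K : Set α}
    (hK : MeasurableSet K) {w : ℝ} (hw : ∀ x ∉ K, w ≤ W x) :
    μ.real Kᶜ * w ≤ ∫ x in Kᶜ, W x ∂μ := by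
  have h1 : ∫ x in Kᶜ, w ∂μ ≤ ∫ x in Kᶜ, W x ∂μ :=
    setIntegral_mono_on (integrable_const _) h.integrable_W.integrableOn hK.compl hw
  simpa using h1

variable [SigmaFinite vol]

lemma integrable_density_mul_W (h : FreeEnergyBound vol μ g V ℓ W θ C₀ C₁ M) :
    Integrable (fun x => (μ.rnDeriv vol x).toReal * (W x / 2)) vol :=
  (integrable_rnDeriv_smul_iff h.ac).2 (h.integrable_W.div_const 2)

lemma integrable_localEnergy (h : FreeEnergyBound vol μ g V ℓ W θ C₀ C₁ M) :
    Integrable (localEnergy vol μ W θ) vol :=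
  (h.integrable_density_mul_W.add (h.integrable_ent.const_mul _)).add
    (h.integrable_exp.const_mul _)

lemma setIntegral_localEnergy (h : FreeEnergyBound vol μ g V ℓ W θ C₀ C₁ M) {K : Set α}
    (hK : MeasurableSet K) :
    ∫ x in K, localEnergy vol μ W θ x ∂vol = (∫ x in K, W x ∂μ) / 2 +
      1 / θ * (∫ x in K, (μ.rnDeriv vol x).toReal * Real.log (μ.rnDeriv vol x).toReal ∂vol) +
      1 / θ * ∫ x in K, Real.exp (-(θ * (W x / 2))) ∂vol := by
  have e1 : ∫ x in K, (μ.rnDeriv vol x).toReal * (W x / 2) ∂vol = (∫ x in K, W x ∂μ) / 2 := by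
    rw [← integral_div]
    exact setIntegral_rnDeriv_smul h.ac hK
  have i1 := h.integrable_density_mul_W.integrableOn (s := K)
  have i2 := (h.integrable_ent.const_mul (1 / θ)).integrableOn (s := K)
  have i3 := (h.integrable_exp.const_mul (1 / θ)).integrableOn (s := K)
  simp only [localEnergy]
  rw [integral_add (i1.fun_add i2) i3, integral_add i1 i2, e1, integral_const_mul, integral_const_mul]

/-- Substituting `V = W + 2ℓ - C₁` makes the energy a sum of nonnegative parts: half the shifted
interaction, `∫ ℓ`, `½ ∫ W` and the local energy, up to the constants `C₁` and `M`. One `ℓ`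
compensates `g`; the second is spare and yields the bound on `∫ ℓ`. -/
lemma integral_bounds (h : FreeEnergyBound vol μ g V ℓ W θ C₀ C₁ M) :
    ∫ x, ℓ x ∂μ ≤ C₀ + C₁ + M ∧ ∫ x, W x ∂μ ≤ 2 * (C₀ + C₁ + M) ∧
      ∫ q : α × α, g q + (ℓ q.1 + ℓ q.2) ∂μ.prod μ ≤ 2 * (C₀ + C₁ + M) ∧
      ∫ x, localEnergy vol μ W θ x ∂vol ≤ C₀ + C₁ + M := by
  have hθ : 0 < θ := by linarith [h.one_le_θ]
  have e1 := h.setIntegral_V Set.univ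
  have e2 := h.setIntegral_localEnergy MeasurableSet.univ
  simp only [probReal_univ, Measure.restrict_univ] at e1 e2
  have e3 := h.integral_g_add
  have n1 : 0 ≤ ∫ q : α × α, g q + (ℓ q.1 + ℓ q.2) ∂μ.prod μ :=
    integral_nonneg fun q => by have := h.le_g q; simp only [Pi.zero_apply]; linarith
  have n2 : 0 ≤ ∫ x, ℓ x ∂μ := integral_nonneg h.ℓ_nonneg
  have n3 : 0 ≤ ∫ x, W x ∂μ := integral_nonneg h.W_nonneg
  have n4 : 0 ≤ ∫ x, localEnergy vol μ W θ x ∂vol := integral_nonneg h.localEnergy_nonneg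
  have n5 : 0 ≤ ∫ x, Real.exp (-(θ * (W x / 2))) ∂vol := integral_nonneg fun x => Real.exp_nonneg _
  have n6 : 1 / θ * ∫ x, Real.exp (-(θ * (W x / 2))) ∂vol ≤ M :=
    (mul_le_of_le_one_left n5 ((div_le_one hθ).2 h.one_le_θ)).trans h.integral_exp_le
  have := h.energy_le
  refine ⟨?_, ?_, ?_, ?_⟩ <;> linarith

/-- Markov's inequality for `W`, whose integral is at most `2(C₀ + C₁ + M)`. -/
lemma measureReal_compl_le_half (h : FreeEnergyBound vol μ g V ℓ W θ C₀ C₁ M) {K : Set α}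
    (hK : MeasurableSet K) (hw : ∀ x ∉ K, 2 * (C₁ + 15 * (C₀ + C₁ + M) + 2) ≤ W x) :
    μ.real Kᶜ ≤ 1 / 2 := by
  have h1 := h.measureReal_compl_mul_le hK hw
  obtain ⟨b1, b2, -, -⟩ := h.integral_bounds
  have h2 : ∫ x in Kᶜ, W x ∂μ ≤ ∫ x, W x ∂μ :=
    setIntegral_le_integral h.integrable_W (Eventually.of_forall h.W_nonneg)
  have h3 : 0 ≤ C₀ + C₁ + M := (integral_nonneg h.ℓ_nonneg).trans b1
  have h4 := h.C₁_nonneg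
  by_contra! hm
  nlinarith

/-- If conditioning `μ` on `K` does not decrease the free energy, then the mass of `μ` outside
`K` is exponentially small. -/
lemma measureReal_compl_le (h : FreeEnergyBound vol μ g V ℓ W θ C₀ C₁ M) {K : Set α}
    (hK : MeasurableSet K) (hw : ∀ x ∉ K, 2 * (C₁ + 15 * (C₀ + C₁ + M) + 2) ≤ W x) {c : ℝ}
    (hc : c * μ.real K = 1)
    (hcond : 1 / 2 * (∫ q, g q ∂μ.prod μ) + ∫ x, V x ∂μ +
      1 / θ * (∫ x, (μ.rnDeriv vol x).toReal * Real.log (μ.rnDeriv vol x).toReal ∂vol) ≤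
      1 / 2 * (c ^ 2 * ∫ q in K ×ˢ K, g q ∂μ.prod μ) + c * ∫ x in K, V x ∂μ +
      1 / θ * (c * (∫ x in K, (μ.rnDeriv vol x).toReal *
        Real.log (μ.rnDeriv vol x).toReal ∂vol) + Real.log c)) :
    μ.real Kᶜ ≤ ∫ x in Kᶜ, Real.exp (-(θ * (W x / 2))) ∂vol := by
  have hθ : 0 < θ := by linarith [h.one_le_θ]
  have hθ1 : 1 / θ ≤ 1 := (div_le_one hθ).2 h.one_le_θ
  have hm := h.measureReal_compl_le_half hK hw
  have hWc := h.measureReal_compl_mul_le hK hw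
  obtain ⟨b1, b2, b3, b4⟩ := h.integral_bounds
  have hm0 : 0 ≤ μ.real Kᶜ := measureReal_nonneg
  have hk : μ.real K = 1 - μ.real Kᶜ := by rw [probReal_compl_eq_one_sub hK]; ring
  have hGnn : ∀ q : α × α, 0 ≤ g q + (ℓ q.1 + ℓ q.2) := fun q => by have := h.le_g q; linarith
  have g1 : ∫ q in K ×ˢ K, g q + (ℓ q.1 + ℓ q.2) ∂μ.prod μ ≤
      ∫ q : α × α, g q + (ℓ q.1 + ℓ q.2) ∂μ.prod μ :=
    setIntegral_le_integral h.integrable_g_add (Eventually.of_forall hGnn)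
  rw [h.integral_g_add] at g1 b3
  rw [h.setIntegral_g_add] at g1
  have n1 : 0 ≤ ∫ x in K, ℓ x ∂μ := integral_nonneg h.ℓ_nonneg
  have n2 : 0 ≤ ∫ x in Kᶜ, ℓ x ∂μ := integral_nonneg h.ℓ_nonneg
  have n3 : 0 ≤ ∫ x in Kᶜ, W x ∂μ := integral_nonneg h.W_nonneg
  have n4 : 0 ≤ 1 / θ * ∫ x in K, Real.exp (-(θ * (W x / 2))) ∂vol :=
    mul_nonneg (one_div_pos.2 hθ).le (integral_nonneg fun x => Real.exp_nonneg _)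
  have sℓ := integral_add_compl hK h.integrable_ℓ
  have sV := integral_add_compl hK h.integrable_V
  have sW := integral_add_compl hK h.integrable_W
  have sE := integral_add_compl hK h.integrable_ent
  have hH : ∫ x in K, localEnergy vol μ W θ x ∂vol ≤ ∫ x, localEnergy vol μ W θ x ∂vol :=
    setIntegral_le_integral h.integrable_localEnergy (Eventually.of_forall h.localEnergy_nonneg)
  rw [h.setIntegral_localEnergy hK] at hH
  have hVK := h.setIntegral_V K
  have hVc := h.setIntegral_V Kᶜ
  -- The local energy dominates the density divided by `θ`; after `key` removes its potential and
  -- entropy parts on `Kᶜ`, only the Gibbs weight is left.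
  have hp : 1 / θ * μ.real Kᶜ ≤ ∫ x in Kᶜ, localEnergy vol μ W θ x ∂vol := by
    have e : ∫ x in Kᶜ, (μ.rnDeriv vol x).toReal ∂vol = μ.real Kᶜ :=
      Measure.setIntegral_toReal_rnDeriv h.ac _
    rw [← e, ← integral_const_mul]
    exact integral_mono (Measure.integrable_toReal_rnDeriv.integrableOn.const_mul _)
      h.integrable_localEnergy.integrableOn h.density_le_localEnergy
  rw [h.setIntegral_localEnergy hK.compl] at hp
  have hC1 := h.C₁_nonneg
  rw [← sV, ← sE] at hcond
  rw [← sℓ] at g1 b1 b3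
  rw [← sW] at b2
  rw [hk] at hc g1 hVK
  have hVS : ∫ x in K, V x ∂μ + 1 / θ * (∫ x in K, (μ.rnDeriv vol x).toReal *
      Real.log (μ.rnDeriv vol x).toReal ∂vol) ≤ 4 * (C₀ + C₁ + M) := by
    have : 0 ≤ C₁ * (1 - μ.real Kᶜ) := mul_nonneg hC1 (by linarith)
    linarith
  have key := half_add_nonpos_of_conditioning hc hm0 hm n1 n2 hθ1 g1 b3 b1 hVS hVc hcond hWc
  exact le_of_mul_le_mul_left (by linarith) (one_div_pos.2 hθ)

end FreeEnergyBound

end FreeEnergyTail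

/-! ### Conditioning and the free energy -/

section Conditioning

lemma cond_prod_cond {α : Type*} [MeasurableSpace α] (ν : Measure α) [SFinite ν]
    (K : Set α) :
    (ProbabilityTheory.cond ν K).prod (ProbabilityTheory.cond ν K) = ((ν K)⁻¹ * (ν K)⁻¹) • (ν.prod ν).restrict (K ×ˢ K) := by
  rw [ProbabilityTheory.cond, Measure.prod_smul_left, Measure.prod_smul_right, Measure.prod_restrict, smul_smul]

lemma entropy_cond_ae_eq {α : Type*} [MeasurableSpace α] {vol ν : Measure α} [SigmaFinite vol]
    [SigmaFinite ν] {K : Set α} (hK : MeasurableSet K) (h0 : ν K ≠ 0) (htop : ν K ≠ ⊤) :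
    (fun x => ((ProbabilityTheory.cond ν K).rnDeriv vol x).toReal * Real.log ((ProbabilityTheory.cond ν K).rnDeriv vol x).toReal)
      =ᵐ[vol] K.indicator fun x => (ν.real K)⁻¹ *
        ((ν.rnDeriv vol x).toReal * Real.log (ν.rnDeriv vol x).toReal) +
        (ν.real K)⁻¹ * Real.log (ν.real K)⁻¹ * (ν.rnDeriv vol x).toReal := by
  have : IsFiniteMeasure (ν.restrict K) := ⟨by simpa using htop.lt_top⟩
  have hc : (ν.real K)⁻¹ ≠ 0 := inv_ne_zero (ENNReal.toReal_ne_zero.2 ⟨h0, htop⟩)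
  filter_upwards [Measure.rnDeriv_restrict ν vol hK,
    Measure.rnDeriv_smul_left_of_ne_top (ν.restrict K) vol (ENNReal.inv_ne_top.2 h0)] with x h1 h2
  rw [ProbabilityTheory.cond, h2, Pi.smul_apply, h1, smul_eq_mul, ENNReal.toReal_mul, ENNReal.toReal_inv,
    ← measureReal_def]
  by_cases hx : x ∈ K
  -- The logarithm of the product splits only where the density is nonzero; elsewhere both sides
  -- vanish.
  · rcases eq_or_ne (ν.rnDeriv vol x).toReal 0 with hp | hp
    · simp [hx, hp]
    · simp only [hx, Set.indicator_of_mem]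
      rw [Real.log_mul hc hp]
      ring
  · simp [hx]

lemma integrableOn_toReal_rnDeriv {α : Type*} [MeasurableSpace α] {vol ν : Measure α} {K : Set α}
    (htop : ν K ≠ ⊤) : IntegrableOn (fun x => (ν.rnDeriv vol x).toReal) K vol :=
  integrable_toReal_of_lintegral_ne_top (Measure.measurable_rnDeriv _ _).aemeasurable
    ((Measure.setLIntegral_rnDeriv_le K).trans_lt htop.lt_top).ne

variable {d : ℕ}

/-- Conditioning multiplies the density by `1/ν(K)`, so the entropy gains `log (1/ν(K))`. Taking `ν`
merely σ-finite covers both Lebesgue measure on a ball (a competitor) and the equilibrium measure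
itself. -/
lemma freeEnergy_cond (V : EuclideanSpace ℝ (Fin d) → ℝ) (θ : ℝ)
    {ν : Measure (EuclideanSpace ℝ (Fin d))} [SigmaFinite ν] (hν : ν ≪ volume)
    {K : Set (EuclideanSpace ℝ (Fin d))} (hK : MeasurableSet K) (h0 : ν K ≠ 0) (htop : ν K ≠ ⊤)
    (hg : IntegrableOn (fun p : EuclideanSpace ℝ (Fin d) × EuclideanSpace ℝ (Fin d) =>
      coulombKernel (p.1 - p.2)) (K ×ˢ K) (ν.prod ν))
    (hV : IntegrableOn V K ν)
    (hent : IntegrableOn (fun x => (ν.rnDeriv volume x).toReal *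
      Real.log (ν.rnDeriv volume x).toReal) K)
    {σ : ProbabilityMeasure (EuclideanSpace ℝ (Fin d))}
    (hσ : (σ : Measure (EuclideanSpace ℝ (Fin d))) = ProbabilityTheory.cond ν K) :
    freeEnergy V θ σ = ((1 / 2 * ((ν.real K)⁻¹ ^ 2 *
        ∫ p in K ×ˢ K, coulombKernel (p.1 - p.2) ∂(ν.prod ν)) +
      (ν.real K)⁻¹ * (∫ x in K, V x ∂ν) +
      1 / θ * ((ν.real K)⁻¹ * (∫ x in K, (ν.rnDeriv volume x).toReal *
        Real.log (ν.rnDeriv volume x).toReal) + Real.log (ν.real K)⁻¹) : ℝ) : EReal) := by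
  have hinv : (ν K)⁻¹ ≠ ⊤ := ENNReal.inv_ne_top.2 h0
  have hk : ν.real K ≠ 0 := ENNReal.toReal_ne_zero.2 ⟨h0, htop⟩
  have hae := entropy_cond_ae_eq (vol := volume) hK h0 htop
  have hp := integrableOn_toReal_rnDeriv (vol := volume) htop
  have i1 := hent.const_mul (ν.real K)⁻¹
  have i2 := hp.const_mul ((ν.real K)⁻¹ * Real.log (ν.real K)⁻¹)
  have hfin : HasFiniteFreeEnergy V σ := by
    rw [HasFiniteFreeEnergy, hσ, cond_prod_cond]
    refine ⟨(ProbabilityTheory.cond_absolutelyContinuous).trans hν, hg.smul_measure (by finiteness),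
      hV.smul_measure hinv, ?_⟩
    rw [integrable_congr hae, integrable_indicator_iff hK]
    exact i1.add i2
  rw [freeEnergy, if_pos hfin, hσ, cond_prod_cond, integral_congr_ae hae,
    integral_indicator hK, integral_add i1 i2, integral_const_mul, integral_const_mul,
    Measure.setIntegral_toReal_rnDeriv' hν hK, ProbabilityTheory.cond, integral_smul_measure, integral_smul_measure,
    ENNReal.toReal_mul, ENNReal.toReal_inv, ← measureReal_def]
  congr 1
  simp only [smul_eq_mul]
  field_simp

end Conditioning

/-! ### The Coulomb kernel -/

section Coulomb

variable {d : ℕ}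

lemma measurable_coulombKernel :
    Measurable (coulombKernel : EuclideanSpace ℝ (Fin d) → ℝ) := by
  unfold coulombKernel
  split_ifs <;> fun_prop

lemma abs_log_le_two_mul_inv {r : ℝ} (h0 : 0 < r) (h2 : r < 2) : |Real.log r| ≤ 2 * r⁻¹ := by
  have h1 := Real.one_sub_inv_le_log_of_pos h0
  have h3 := Real.log_le_sub_one_of_pos h0
  have h4 : 1 < 2 * r⁻¹ := by rw [← div_eq_mul_inv, one_lt_div h0]; exact h2
  have h5 : 0 < r⁻¹ := inv_pos.2 h0
  rw [abs_le]
  constructor <;> linarith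

lemma integrableOn_coulombKernel_ball (hd : 2 ≤ d) :
    IntegrableOn (coulombKernel : EuclideanSpace ℝ (Fin d) → ℝ) (Metric.ball 0 2) := by
  have hfin : Module.finrank ℝ (EuclideanSpace ℝ (Fin d)) = d := by simp
  have hd' : (2 : ℝ) ≤ d := by exact_mod_cast hd
  have : Nontrivial (EuclideanSpace ℝ (Fin d)) :=
    Module.nontrivial_of_finrank_pos (R := ℝ) (by omega)
  have hne : ∀ᵐ x ∂(volume : Measure (EuclideanSpace ℝ (Fin d))), x ≠ 0 := by
    simp [ae_iff]
  by_cases h2 : d = 2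
  · refine integrableOn_ball_of_norm_le_rpow (C := 1 / (2 * Real.pi) * 2) (α := 1) (by omega)
      (by rw [hfin]; linarith) ?_ measurable_coulombKernel.aestronglyMeasurable
    filter_upwards [ae_restrict_of_ae hne, ae_restrict_mem measurableSet_ball] with x hx hx2
    have h := abs_log_le_two_mul_inv (norm_pos_iff.2 hx) (mem_ball_zero_iff.1 hx2)
    rw [coulombKernel, if_pos h2, Real.rpow_neg_one, norm_mul, norm_neg, Real.norm_eq_abs,
      Real.norm_eq_abs, abs_of_pos (by positivity), mul_assoc]
    gcongr
  · refine integrableOn_ball_of_norm_le_rpow (C := ‖1 / (((d : ℝ) - 2) *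
      (d * (volume : Measure (EuclideanSpace ℝ (Fin d))).real (Metric.ball 0 1)))‖)
      (α := ((d - 2 : ℕ) : ℝ)) (by omega)
      (by rw [hfin]; exact_mod_cast (by omega)) ?_ measurable_coulombKernel.aestronglyMeasurable
    refine Eventually.of_forall fun x => ?_
    rw [coulombKernel, if_neg h2, norm_div, Real.rpow_neg (norm_nonneg _), Real.rpow_natCast,
      norm_pow, norm_norm, div_eq_mul_inv]

lemma integrableOn_coulombKernel_sub (hd : 2 ≤ d) :
    IntegrableOn (fun p : EuclideanSpace ℝ (Fin d) × EuclideanSpace ℝ (Fin d) =>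
      coulombKernel (p.1 - p.2)) (Metric.ball 0 1 ×ˢ Metric.ball 0 1)
      ((volume : Measure (EuclideanSpace ℝ (Fin d))).prod volume) := by
  have h1 : Integrable ((Metric.ball (0 : EuclideanSpace ℝ (Fin d)) 1).indicator
      fun _ => (1 : ℝ)) :=
    (integrable_indicator_iff measurableSet_ball).2
      (integrableOn_const measure_ball_lt_top.ne)
  have h2 := (integrable_indicator_iff measurableSet_ball).2 (integrableOn_coulombKernel_ball hd)
  -- On the product of unit balls the kernel agrees with the convolution integrand of two integrable
  -- functions, since differences lie in the ball of radius 2.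
  refine ((h1.convolution_integrand (ContinuousLinearMap.mul ℝ ℝ) h2).integrableOn
    (s := Metric.ball 0 1 ×ˢ Metric.ball 0 1)).congr_fun ?_
    (measurableSet_ball.prod measurableSet_ball)
  rintro ⟨x, y⟩ ⟨hx, hy⟩
  have hxy : x - y ∈ Metric.ball (0 : EuclideanSpace ℝ (Fin d)) 2 := by
    rw [mem_ball_zero_iff] at *
    linarith [norm_sub_le x y]
  simp only at hy
  simp [Set.indicator_of_mem hxy, Set.indicator_of_mem hy]

lemma coulombKernel_nonneg (hd : 2 < d) (x : EuclideanSpace ℝ (Fin d)) : 0 ≤ coulombKernel x := by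
  have : (2 : ℝ) < d := by exact_mod_cast hd
  rw [coulombKernel, if_neg (by omega)]
  have : 0 ≤ (d : ℝ) - 2 := by linarith
  positivity

lemma log_norm_sub_le {F : Type*} [NormedAddCommGroup F] (x y : F) :
    Real.log ‖x - y‖ ≤ Real.log (1 + ‖x‖) + Real.log (1 + ‖y‖) := by
  rw [← Real.log_mul (by positivity) (by positivity)]
  rcases eq_or_ne (x - y) 0 with h | h
  · rw [h, norm_zero, Real.log_zero]
    exact Real.log_nonneg (by nlinarith [norm_nonneg x, norm_nonneg y])
  · exact Real.log_le_log (norm_pos_iff.2 h)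
      ((norm_sub_le x y).trans (by nlinarith [norm_nonneg x, norm_nonneg y]))

lemma log_one_add_le_two_mul_log {r : ℝ} (hr : 2 ≤ r) : Real.log (1 + r) ≤ 2 * Real.log r := by
  rw [← Real.log_rpow (by linarith)]
  exact Real.log_le_log (by linarith) (by norm_num; nlinarith)

/-- The negative part of the Coulomb interaction is controlled by a one-body function that is
small compared to the confining potential. -/
lemma exists_coulombKernel_lower_bound (hd : 2 ≤ d) (V : EuclideanSpace ℝ (Fin d) → ℝ) :
    ∃ ℓ : EuclideanSpace ℝ (Fin d) → ℝ, Continuous ℓ ∧ (∀ x, 0 ≤ ℓ x) ∧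
      (∀ x y, -ℓ x - ℓ y ≤ coulombKernel (x - y)) ∧
      ∀ x, 2 ≤ ‖x‖ → confinement V x ≤ V x - 2 * ℓ x := by
  rcases hd.eq_or_lt with rfl | hd
  · have hpi := Real.pi_gt_three
    -- This choice comes from `|x - y| ≤ (1 + |x|)(1 + |y|)`. For `|x| ≥ 2`, `2ℓ = log(1 + |x|)/π ≤
    -- log |x|`, as `1/π ≤ 1/2` and `1 + |x| ≤ |x|²`.
    refine ⟨fun x => 1 / (2 * Real.pi) * Real.log (1 + ‖x‖), ?_, fun x => ?_, fun x y => ?_,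
      fun x hx => ?_⟩
    · have hc : Continuous fun x : EuclideanSpace ℝ (Fin 2) => 1 + ‖x‖ := by fun_prop
      exact continuous_const.mul (hc.log fun x => by positivity)
    · exact mul_nonneg (by positivity) (Real.log_nonneg (by linarith [norm_nonneg x]))
    · have := mul_le_mul_of_nonneg_left (log_norm_sub_le x y)
        (show 0 ≤ 1 / (2 * Real.pi) by positivity)
      rw [coulombKernel, if_pos rfl]
      linarith
    · have h1 : 2 * (1 / (2 * Real.pi)) ≤ 1 / 2 := by
        rw [show 2 * (1 / (2 * Real.pi)) = 1 / Real.pi by field_simp]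
        exact one_div_le_one_div_of_le (by norm_num) (by linarith)
      have h2 := mul_le_mul_of_nonneg_right h1
        (Real.log_nonneg (show 1 ≤ 1 + ‖x‖ by linarith))
      have h3 := log_one_add_le_two_mul_log hx
      rw [confinement, if_pos rfl]
      linarith
  · refine ⟨0, continuous_const, fun _ => le_rfl, fun x y => ?_, fun x _ => ?_⟩
    · simpa using coulombKernel_nonneg hd (x - y)
    · simp [confinement, show d ≠ 2 by omega]

/-- The uniform measure on the unit ball is a competitor for every `θ`; its entropy is constant and
enters with weight `1/θ ≤ 1`. -/
lemma exists_freeEnergy_le (hd : 2 ≤ d) {V : EuclideanSpace ℝ (Fin d) → ℝ} (hV : Continuous V) :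
    ∃ C : ℝ, ∀ θ : ℝ, 1 ≤ θ → ∃ σ : ProbabilityMeasure (EuclideanSpace ℝ (Fin d)),
      freeEnergy V θ σ ≤ C := by
  set B := Metric.ball (0 : EuclideanSpace ℝ (Fin d)) 1
  have h0 : volume B ≠ 0 := (Metric.measure_ball_pos _ _ one_pos).ne'
  have htop : volume B ≠ ⊤ := measure_ball_lt_top.ne
  have hone : (fun x => ((volume : Measure (EuclideanSpace ℝ (Fin d))).rnDeriv volume x).toReal *
      Real.log ((volume : Measure (EuclideanSpace ℝ (Fin d))).rnDeriv volume x).toReal)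
      =ᵐ[volume] 0 := by
    filter_upwards [Measure.rnDeriv_self (volume : Measure (EuclideanSpace ℝ (Fin d)))] with x hx
    simp [hx]
  have hVB : IntegrableOn V B :=
    (hV.continuousOn.integrableOn_compact (isCompact_closedBall 0 1)).mono_set
      Metric.ball_subset_closedBall
  refine ⟨1 / 2 * (((volume : Measure (EuclideanSpace ℝ (Fin d))).real B)⁻¹ ^ 2 *
    ∫ p in B ×ˢ B, coulombKernel (p.1 - p.2)
      ∂((volume : Measure (EuclideanSpace ℝ (Fin d))).prod volume)) +
    ((volume : Measure (EuclideanSpace ℝ (Fin d))).real B)⁻¹ * (∫ x in B, V x) +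
    |Real.log ((volume : Measure (EuclideanSpace ℝ (Fin d))).real B)⁻¹|, fun θ hθ => ?_⟩
  let σ : ProbabilityMeasure (EuclideanSpace ℝ (Fin d)) := ⟨ProbabilityTheory.cond volume B,
    ProbabilityTheory.cond_isProbabilityMeasure_of_finite h0 htop⟩
  refine ⟨σ, ?_⟩
  rw [freeEnergy_cond (σ := σ) V θ Measure.AbsolutelyContinuous.rfl measurableSet_ball h0 htop
    (integrableOn_coulombKernel_sub hd) hVB
    ((integrable_congr (ae_restrict_of_ae hone)).2 (integrable_zero _ _ _)) rfl,
    integral_congr_ae (ae_restrict_of_ae hone), EReal.coe_le_coe_iff]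
  simp only [Pi.zero_apply, integral_zero, mul_zero, zero_add]
  gcongr
  calc 1 / θ * Real.log ((volume : Measure (EuclideanSpace ℝ (Fin d))).real B)⁻¹
      ≤ 1 / θ * |Real.log ((volume : Measure (EuclideanSpace ℝ (Fin d))).real B)⁻¹| := by
        gcongr
        exact le_abs_self _
    _ ≤ _ := mul_le_of_le_one_left (abs_nonneg _) ((div_le_one (by linarith)).2 hθ)

end Coulomb

/-! ### Tails of the thermal equilibrium measure -/

section ThermalEquilibrium

variable {d : ℕ}

lemma IsThermalEquilibrium.energy_le {V : EuclideanSpace ℝ (Fin d) → ℝ} {θ C : ℝ}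
    {μ σ : ProbabilityMeasure (EuclideanSpace ℝ (Fin d))} (hμ : IsThermalEquilibrium V θ μ)
    (hσ : freeEnergy V θ σ ≤ C) : HasFiniteFreeEnergy V μ ∧ freeEnergy V θ μ ≤ C := by
  have h := (hμ σ).trans hσ
  refine ⟨?_, h⟩
  by_contra hfin
  rw [freeEnergy, if_neg hfin] at h
  exact absurd (h.trans_lt (EReal.coe_lt_top C)) (lt_irrefl _)

lemma freeEnergy_of_hasFinite {V : EuclideanSpace ℝ (Fin d) → ℝ} {θ : ℝ}
    {μ : ProbabilityMeasure (EuclideanSpace ℝ (Fin d))} (h : HasFiniteFreeEnergy V μ) :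
    freeEnergy V θ μ = ((1 / 2 * (∫ p : EuclideanSpace ℝ (Fin d) × EuclideanSpace ℝ (Fin d),
        coulombKernel (p.1 - p.2) ∂((μ : Measure (EuclideanSpace ℝ (Fin d))).prod μ)) +
      (∫ x, V x ∂(μ : Measure (EuclideanSpace ℝ (Fin d)))) +
      1 / θ * (∫ x, ((μ : Measure (EuclideanSpace ℝ (Fin d))).rnDeriv volume x).toReal *
        Real.log ((μ : Measure (EuclideanSpace ℝ (Fin d))).rnDeriv volume x).toReal) : ℝ) :
      EReal) := by
  rw [freeEnergy, if_pos h]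

lemma IsThermalEquilibrium.measureReal_compl_le {V ℓ W : EuclideanSpace ℝ (Fin d) → ℝ}
    {θ C₀ C₁ M : ℝ} {μ : ProbabilityMeasure (EuclideanSpace ℝ (Fin d))}
    (hμ : IsThermalEquilibrium V θ μ) (hfin : HasFiniteFreeEnergy V μ)
    (hb : FreeEnergyBound volume (μ : Measure (EuclideanSpace ℝ (Fin d)))
      (fun p => coulombKernel (p.1 - p.2)) V ℓ W θ C₀ C₁ M)
    {K : Set (EuclideanSpace ℝ (Fin d))} (hK : MeasurableSet K)
    (hw : ∀ x ∉ K, 2 * (C₁ + 15 * (C₀ + C₁ + M) + 2) ≤ W x) :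
    (μ : Measure (EuclideanSpace ℝ (Fin d))).real Kᶜ ≤
      ∫ x in Kᶜ, Real.exp (-(θ * (W x / 2))) := by
  have hhalf := hb.measureReal_compl_le_half hK hw
  have hk : (μ : Measure (EuclideanSpace ℝ (Fin d))).real K ≠ 0 := by
    have := probReal_compl_eq_one_sub (μ := (μ : Measure (EuclideanSpace ℝ (Fin d)))) hK
    intro h
    linarith
  have h0 : (μ : Measure (EuclideanSpace ℝ (Fin d))) K ≠ 0 := fun h => hk (by simp [Measure.real, h])
  have htop := measure_ne_top (μ : Measure (EuclideanSpace ℝ (Fin d))) K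
  let σ : ProbabilityMeasure (EuclideanSpace ℝ (Fin d)) :=
    ⟨ProbabilityTheory.cond (μ : Measure (EuclideanSpace ℝ (Fin d))) K,
      ProbabilityTheory.cond_isProbabilityMeasure h0⟩
  have hle := hμ σ
  rw [freeEnergy_of_hasFinite hfin, freeEnergy_cond (σ := σ) V θ hfin.1 hK h0 htop
    hb.integrable_g.integrableOn hb.integrable_V.integrableOn hb.integrable_ent.integrableOn rfl,
    EReal.coe_le_coe_iff] at hle
  exact hb.measureReal_compl_le hK hw (inv_mul_cancel₀ hk) hle

lemma tendsto_atTop_cocompact_of_le {F : Type*} [NormedAddCommGroup F] [ProperSpace F]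
    {f g : F → ℝ} {R : ℝ} (hf : Tendsto f (cocompact F) atTop) (hfg : ∀ x, R ≤ ‖x‖ → f x ≤ g x) :
    Tendsto g (cocompact F) atTop := by
  refine tendsto_atTop_mono' _ ?_ hf
  filter_upwards [(isCompact_closedBall (0 : F) R).compl_mem_cocompact] with x hx
  exact hfg x (by simpa using (not_le.1 (mt mem_closedBall_zero_iff.2 hx)).le)

lemma exists_closedBall_forall_le {F : Type*} [NormedAddCommGroup F] [ProperSpace F]
    {f : F → ℝ} (hf : Tendsto f (cocompact F) atTop) (c R : ℝ) :
    ∃ R' : ℝ, R ≤ R' ∧ ∀ x ∉ Metric.closedBall (0 : F) R', c ≤ f x := by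
  obtain ⟨t, ht, hsub⟩ := mem_cocompact.1 (hf.eventually_ge_atTop c)
  obtain ⟨r, hr⟩ := ht.isBounded.subset_closedBall (0 : F)
  refine ⟨max R r, le_max_left _ _, fun x hx => hsub fun hxt => hx ?_⟩
  exact Metric.closedBall_subset_closedBall (le_max_right _ _) (hr hxt)

/-- Outside a fixed compact set, the mass of the thermal equilibrium measure is bounded by a
Gibbs weight of the confining potential, provided that weight is at most one. -/
lemma exists_isCompact_measure_compl_le (hd : 2 ≤ d) {V : EuclideanSpace ℝ (Fin d) → ℝ}
    (hV : Continuous V) (hV_growth : Tendsto (confinement V) (cocompact _) atTop)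
    {K₀ : Set (EuclideanSpace ℝ (Fin d))} (hK₀ : IsCompact K₀) :
    ∃ K : Set (EuclideanSpace ℝ (Fin d)), IsCompact K ∧ ∀ θ : ℝ, 1 ≤ θ →
      ∀ μ : ProbabilityMeasure (EuclideanSpace ℝ (Fin d)), IsThermalEquilibrium V θ μ →
      ∫⁻ x in K₀ᶜ, ENNReal.ofReal (Real.exp (-(1 / 2 * θ * confinement V x))) ≤ 1 →
      (μ : Measure (EuclideanSpace ℝ (Fin d))) Kᶜ ≤
        ∫⁻ x in K₀ᶜ, ENNReal.ofReal (Real.exp (-(1 / 2 * θ * confinement V x))) := by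
  obtain ⟨ℓ, hℓc, hℓ0, hℓg, hℓV⟩ := exists_coulombKernel_lower_bound hd V
  obtain ⟨C₀, hC₀⟩ := exists_freeEnergy_le hd hV
  obtain ⟨r, hr⟩ := hK₀.isBounded.subset_closedBall (0 : EuclideanSpace ℝ (Fin d))
  have hWlim := tendsto_atTop_cocompact_of_le (g := fun x => V x - 2 * ℓ x) hV_growth hℓV
  have hWc : Continuous fun x => V x - 2 * ℓ x := by fun_prop
  obtain ⟨x₀, hx₀⟩ := hWc.exists_forall_le hWlim
  -- Shifting by the absolute value of the minimum makes `W` nonnegative.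
  set C₁ : ℝ := |V x₀ - 2 * ℓ x₀|
  set W : EuclideanSpace ℝ (Fin d) → ℝ := fun x => V x - 2 * ℓ x + C₁ with hW
  have hWnn : ∀ x, 0 ≤ W x := fun x => by
    have := hx₀ x
    have := neg_abs_le (V x₀ - 2 * ℓ x₀)
    simp only [hW]
    linarith
  have hUW : ∀ x, 2 ≤ ‖x‖ → confinement V x ≤ W x := fun x hx =>
    (hℓV x hx).trans (le_add_of_nonneg_right (abs_nonneg _))
  set B := Metric.closedBall (0 : EuclideanSpace ℝ (Fin d)) (max 2 r)
  have hBK : Bᶜ ⊆ K₀ᶜ := Set.compl_subset_compl.2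
    (hr.trans (Metric.closedBall_subset_closedBall (le_max_right _ _)))
  -- Bounds the total Gibbs weight: the integrand is at most one on `B`, and the weight outside `B`
  -- is at most `T ≤ 1`.
  set M : ℝ := (volume : Measure (EuclideanSpace ℝ (Fin d))).real B + 1
  -- The radius depends only on `C₀`, `C₁` and `M`, hence not on `θ` or `μ`.
  obtain ⟨R, hR, hRW⟩ := exists_closedBall_forall_le
    (tendsto_atTop_cocompact_of_le hV_growth hUW) (2 * (C₁ + 15 * (C₀ + C₁ + M) + 2)) (max 2 r)
  refine ⟨Metric.closedBall 0 R, isCompact_closedBall _ _, fun θ hθ μ hμ hT => ?_⟩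
  set T := ∫⁻ x in K₀ᶜ, ENNReal.ofReal (Real.exp (-(1 / 2 * θ * confinement V x)))
  have hθ0 : 0 ≤ θ := by linarith
  have hexp : ∫⁻ x in Bᶜ, ENNReal.ofReal (Real.exp (-(θ * (W x / 2)))) ≤ T := by
    refine (setLIntegral_mono_ae' measurableSet_closedBall.compl
      (Eventually.of_forall fun x hx => ?_)).trans (lintegral_mono_set hBK)
    have hx2 : 2 ≤ ‖x‖ := by
      have := not_le.1 (mt mem_closedBall_zero_iff.2 hx)
      exact (le_max_left _ _).trans this.le
    have := mul_le_mul_of_nonneg_left (hUW x hx2) hθ0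
    refine ENNReal.ofReal_le_ofReal (Real.exp_le_exp.2 ?_)
    linarith
  have hcont : Continuous fun x => Real.exp (-(θ * (W x / 2))) := by fun_prop
  have htotal : ∫⁻ x, ENNReal.ofReal (Real.exp (-(θ * (W x / 2)))) ≤ ENNReal.ofReal M := by
    rw [← lintegral_add_compl _ (measurableSet_closedBall (x := (0 : EuclideanSpace ℝ (Fin d)))
      (ε := max 2 r)), ENNReal.ofReal_add measureReal_nonneg zero_le_one, ENNReal.ofReal_one,
      ofReal_measureReal measure_closedBall_lt_top.ne]
    refine add_le_add ?_ (hexp.trans hT)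
    refine (setLIntegral_mono_ae' measurableSet_closedBall
      (Eventually.of_forall fun x _ => ?_)).trans_eq (setLIntegral_one B)
    rw [ENNReal.ofReal_le_one, Real.exp_le_one_iff]
    have := mul_nonneg hθ0 (div_nonneg (hWnn x) zero_le_two)
    linarith
  have hexp_int : Integrable fun x => Real.exp (-(θ * (W x / 2))) := by
    refine ⟨hcont.aestronglyMeasurable, ?_⟩
    rw [hasFiniteIntegral_iff_ofReal (Eventually.of_forall fun x => Real.exp_nonneg _)]
    exact htotal.trans_lt ENNReal.ofReal_lt_top
  obtain ⟨σ, hσ⟩ := hC₀ θ hθ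
  obtain ⟨hfin, hle⟩ := hμ.energy_le hσ
  rw [freeEnergy_of_hasFinite hfin, EReal.coe_le_coe_iff] at hle
  have hb : FreeEnergyBound volume (μ : Measure (EuclideanSpace ℝ (Fin d)))
      (fun p => coulombKernel (p.1 - p.2)) V ℓ W θ C₀ C₁ M :=
    { ac := hfin.1
      integrable_g := hfin.2.1
      integrable_V := hfin.2.2.1
      integrable_ent := hfin.2.2.2
      measurable_ℓ := hℓc.measurable
      ℓ_nonneg := hℓ0
      W_nonneg := hWnn
      W_eq := fun x => rfl
      le_g := fun q => hℓg q.1 q.2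
      one_le_θ := hθ
      C₁_nonneg := abs_nonneg _
      integrable_exp := hexp_int
      integral_exp_le := by
        rw [integral_eq_lintegral_of_nonneg_ae (Eventually.of_forall fun x => Real.exp_nonneg _)
          hcont.aestronglyMeasurable]
        exact ENNReal.toReal_le_of_le_ofReal (by positivity) htotal
      energy_le := hle }
  have hmain := hμ.measureReal_compl_le hfin hb measurableSet_closedBall hRW
  rw [← ofReal_measureReal (measure_ne_top _ _)]
  refine (ENNReal.ofReal_le_ofReal hmain).trans ?_
  rw [ofReal_integral_eq_lintegral_ofReal hexp_int.integrableOn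
    (Eventually.of_forall fun x => Real.exp_nonneg _)]
  exact (lintegral_mono_set (Set.compl_subset_compl.2
    (Metric.closedBall_subset_closedBall hR))).trans hexp

end ThermalEquilibrium

/-! ### Conclusion at scale `N^{-1/d}` -/

lemma eventually_measure_compl_le {d : ℕ} (hd : 2 ≤ d)
    {V : EuclideanSpace ℝ (Fin d) → ℝ} (hV : Continuous V)
    (hV_growth : Tendsto (confinement V) (cocompact (EuclideanSpace ℝ (Fin d))) atTop)
    {β : ℕ → ℝ} (hβ : Tendsto (fun N : ℕ => (N : ℝ) * β N) atTop atTop)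
    (hβ_tail : ∃ K : Set (EuclideanSpace ℝ (Fin d)), IsCompact K ∧ ∀ c : ℝ, 0 < c →
      Tendsto (fun N : ℕ => ENNReal.ofReal ((N : ℝ) ^ (1 / (d : ℝ))) *
        ∫⁻ x in Kᶜ, ENNReal.ofReal (Real.exp (-(c * ((N : ℝ) * β N) * confinement V x))))
        atTop (𝓝 0))
    {μ : ℕ → ProbabilityMeasure (EuclideanSpace ℝ (Fin d))}
    (hμ : ∀ᶠ N : ℕ in atTop, IsThermalEquilibrium V ((N : ℝ) * β N) (μ N))
    {ε : ℝ} (hε : 0 < ε) :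
    ∃ K : Set (EuclideanSpace ℝ (Fin d)), IsCompact K ∧ ∀ᶠ N : ℕ in atTop,
      (μ N : Measure (EuclideanSpace ℝ (Fin d))) Kᶜ ≤
        ENNReal.ofReal (ε / (N : ℝ) ^ (1 / (d : ℝ))) := by
  obtain ⟨K₀, hK₀, htail⟩ := hβ_tail
  obtain ⟨K, hK, hbound⟩ := exists_isCompact_measure_compl_le hd hV hV_growth hK₀
  refine ⟨K, hK, ?_⟩
  -- The bound by `1` meets the condition of `hbound`, as `N^{1/d} ≥ 1`; the bound by `ε` gives the
  -- claim.
  have hpos : (0 : ℝ≥0∞) < min 1 (ENNReal.ofReal ε) := lt_min one_pos (ENNReal.ofReal_pos.2 hε)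
  filter_upwards [hμ, hβ.eventually_ge_atTop 1, eventually_ge_atTop 1,
    (htail (1 / 2) (by norm_num)).eventually_le_const hpos] with N h1 h2 h3 h4
  have hN : (1 : ℝ) ≤ (N : ℝ) ^ (1 / (d : ℝ)) :=
    Real.one_le_rpow (by exact_mod_cast h3) (by positivity)
  have hT : ∫⁻ x in K₀ᶜ, ENNReal.ofReal
      (Real.exp (-(1 / 2 * ((N : ℝ) * β N) * confinement V x))) ≤ 1 :=
    (le_mul_of_one_le_left zero_le (ENNReal.one_le_ofReal.2 hN)).trans
      (h4.trans (min_le_left _ _))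
  refine (hbound _ h2 _ h1 hT).trans ?_
  rw [ENNReal.ofReal_div_of_pos (by linarith), ENNReal.le_div_iff_mul_le
    (Or.inl (ENNReal.ofReal_pos.2 (by linarith)).ne') (Or.inl ENNReal.ofReal_ne_top), mul_comm]
  exact h4.trans (min_le_right _ _)

theorem mainTheorem10 (d : ℕ) (hd : 2 ≤ d)
    (V : EuclideanSpace ℝ (Fin d) → ℝ) (hV : ContDiff ℝ 2 V) (hV_nonneg : ∀ x, 0 ≤ V x)
    (hV_growth : Tendsto (confinement V) (cocompact (EuclideanSpace ℝ (Fin d))) atTop)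
    (β : ℕ → ℝ) (hβ : Tendsto (fun N : ℕ => (N : ℝ) * β N) atTop atTop)
    (hβ_tail : ∃ K : Set (EuclideanSpace ℝ (Fin d)), IsCompact K ∧ ∀ c : ℝ, 0 < c →
      Tendsto (fun N : ℕ => ENNReal.ofReal ((N : ℝ) ^ (1 / (d : ℝ))) *
        ∫⁻ x in Kᶜ, ENNReal.ofReal (Real.exp (-(c * ((N : ℝ) * β N) * confinement V x))))
        atTop (𝓝 0))
    (μ : ℕ → ProbabilityMeasure (EuclideanSpace ℝ (Fin d)))
    (hμ : ∀ᶠ N : ℕ in atTop, IsThermalEquilibrium V ((N : ℝ) * β N) (μ N))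
    (ε : ℝ) (hε : 0 < ε)
    (ν : ℕ → ProbabilityMeasure (EuclideanSpace ℝ (Fin d)))
    (hν : ∀ᶠ N : ℕ in atTop,
      ENNReal.ofReal (ε / (N : ℝ) ^ (1 / (d : ℝ))) ≤ blNorm (probDiff (ν N) (μ N))) :
    ∃ Kstar : Set (EuclideanSpace ℝ (Fin d)), IsCompact Kstar ∧
      ∀ᶠ N : ℕ in atTop, ∀ K : Set (EuclideanSpace ℝ (Fin d)), IsCompact K → Kstar ⊆ K →
        ENNReal.ofReal (ε / (4 * (N : ℝ) ^ (1 / (d : ℝ)))) ≤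
          blNorm ((probDiff (ν N) (μ N)).restrict K) := by
  obtain ⟨Kstar, hKs, hev⟩ := eventually_measure_compl_le hd hV.continuous hV_growth hβ hβ_tail hμ
    (show 0 < ε / 4 by linarith)
  refine ⟨Kstar, hKs, ?_⟩
  filter_upwards [hν, hev] with N h1 h2 K hK hsub
  set a := ENNReal.ofReal (ε / (4 * (N : ℝ) ^ (1 / (d : ℝ)))) with ha
  have e1 : ENNReal.ofReal (ε / 4 / (N : ℝ) ^ (1 / (d : ℝ))) = a := by rw [ha, div_div]
  have e2 : ENNReal.ofReal (ε / (N : ℝ) ^ (1 / (d : ℝ))) = 2 * a + 2 * a := by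
    have : ε / (N : ℝ) ^ (1 / (d : ℝ)) = 4 * (ε / (4 * (N : ℝ) ^ (1 / (d : ℝ)))) := by
      rw [← div_div]
      ring
    rw [this, ENNReal.ofReal_mul (by norm_num), ← ha, ← add_mul]
    norm_num
  -- With `a = ε / (4 N^{1/d})` this reads `4a ≤ 2‖(ν - μ) 1_K‖ + 2 μ(Kᶜ)`. Since `μ(Kᶜ) ≤ a`,
  -- cancelling `2a` leaves the claim.
  have h3 := h1.trans (blNorm_probDiff_le (ν N) (μ N) hK.measurableSet)
  have h4 : (μ N : Measure (EuclideanSpace ℝ (Fin d))) Kᶜ ≤ a :=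
    (measure_mono (Set.compl_subset_compl.2 hsub)).trans (h2.trans_eq e1)
  rw [e2] at h3
  have h5 := h3.trans (add_le_add_right (mul_le_mul_right h4 2) _)
  have h6 := ENNReal.le_of_add_le_add_right (by finiteness) h5
  exact (ENNReal.mul_le_mul_iff_right two_ne_zero ENNReal.ofNat_ne_top).1 h6
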